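/- Let $K$ be an algebraically closed field of characteristic zero, let $d\ge 3$ be an integer, and write $d=2k+\varepsilon$ with $\varepsilon\in\{0,1\}$. Let $S_d\subset\mathbb{P}^{k+2}$ be the image of the morphism $\varphi:\mathbb{P}^2\to\mathbb{P}^{k+2}$ given by the generators $$x^d,\ y^d,\ z^d,\ x^ky^kz^{\varepsilon},\ x^{k-1}y^{k-1}z^{\varepsilon+2},\ \ldots,\ xyz^{d-2}$$ of the generalized classical Togliatti system, taken in this order. Let $x_0,\ldots,x_{k+2}$ be the corresponding homogeneous coordinates on $\mathbb{P}^{k+2}$, set $R=K[x_0,\ldots,x_{k+2}]$, and let $I(S_d)\subset R$ be the homogeneous ideal of $S_d$, that is, the ideal generated by the homogeneous polynomials vanishing on $S_d$. For a matrix $M$ with entries in $R$, let $I_2(M)$ denote the ideal generated by its $2\times 2$ minors. (1) If $d=2k+1$ is odd, then $I(S_d)=I_2(\mathcal{A})$, where $\mathcal{A}$ is the $2\times(k+1)$ matrix $$\mathcal{A}=\begin{pmatrix}x_3&x_4&\cdots&x_{k+1}&x_{k+2}&x_0x_1\\ x_4&x_5&\cdots&x_{k+2}&x_2&x_3^2\end{pmatrix}.$$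 In particular, $I(S_d)$ is generated by $\binom{k}{2}$ quadrics and $k$ cubics. (2) If $d=2k$ is even, then $I(S_d)=I_2(\mathcal{B})+(x_0x_1-x_3^2)$, where $\mathcal{B}$ is the $2\times k$ matrix $$\mathcal{B}=\begin{pmatrix}x_3&x_4&\cdots&x_{k+1}&x_{k+2}\\ x_4&x_5&\cdots&x_{k+2}&x_2\end{pmatrix}.$$ In particular, $I(S_d)$ is generated by $1+\binom{k}{2}$ quadrics. (Here a quadric, respectively a cubic, is a nonzero homogeneous polynomial of degree $2$, respectively $3$, and the generators counted are pairwise distinct.) -/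

import Mathlib

open MvPolynomial LinearAlgebra.Projectivization

noncomputable section

namespace GTSurface

/-- With `d = 2k + ε`, the monomials
`x^d, y^d, z^d, x^k y^k z^ε, x^(k-1) y^(k-1) z^(ε+2), …, x y z^(d-2)` of `K[x,y,z]`, in this order
(here `x = X 0`, `y = X 1`, `z = X 2`).  For `ε ≤ 1` they are the `k + 3` generators of the
generalized classical Togliatti system of degree `d`. -/
def generator (K : Type*) [Field K] (k ε : ℕ) : Fin (k + 3) → MvPolynomial (Fin 3) K :=
  Matrix.vecCons (X 0 ^ (2 * k + ε)) <| Matrix.vecCons (X 1 ^ (2 * k + ε)) <|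
    Matrix.vecCons (X 2 ^ (2 * k + ε)) fun j : Fin k =>
      X 0 ^ (k - (j : ℕ)) * X 1 ^ (k - (j : ℕ)) * X 2 ^ (ε + 2 * (j : ℕ))

/-- The map of affine cones `K³ → K^(k+3)` given by the generators. -/
def coneMap (K : Type*) [Field K] (k ε : ℕ) (v : Fin 3 → K) : Fin (k + 3) → K :=
  fun i => eval v (generator K k ε i)

theorem coneMap_smul {K : Type*} [Field K] (k ε : ℕ) (t : K) (v : Fin 3 → K) :
    coneMap K k ε (t • v) = t ^ (2 * k + ε) • coneMap K k ε v := by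
  funext i
  refine Fin.cases ?_ (fun i => Fin.cases ?_ (fun i => Fin.cases ?_ (fun j => ?_) i) i) i
  · simp [coneMap, generator, mul_pow]
  · simp [coneMap, generator, mul_pow]
  · simp [coneMap, generator, mul_pow]
  · have h : 2 * k + ε = (k - (j : ℕ)) + (k - (j : ℕ)) + (ε + 2 * (j : ℕ)) := by
      have := j.isLt
      omega
    simp only [coneMap, generator, Matrix.cons_val_succ, map_mul, map_pow, eval_X,
      Pi.smul_apply, smul_eq_mul, mul_pow]
    rw [h, pow_add, pow_add]
    ring

theorem coneMap_ne_zero {K : Type*} [Field K] (k ε : ℕ) {v : Fin 3 → K} (hv : v ≠ 0) :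
    coneMap K k ε v ≠ 0 := by
  intro h
  apply hv
  have h0 := congrFun h 0
  have h1 := congrFun h (Fin.succ 0)
  have h2 := congrFun h (Fin.succ (Fin.succ 0))
  simp only [coneMap, generator, Matrix.cons_val_zero, Matrix.cons_val_succ, map_pow, eval_X,
    Pi.zero_apply] at h0 h1 h2
  funext i
  fin_cases i
  · exact eq_zero_of_pow_eq_zero h0
  · exact eq_zero_of_pow_eq_zero h1
  · exact eq_zero_of_pow_eq_zero h2

/-- The morphism `φ : ℙ² → ℙ^(k+2)` given by the generators, on `K`-points. -/
def morphism (K : Type*) [Field K] (k ε : ℕ) :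
    ℙ K (Fin 3 → K) → ℙ K (Fin (k + 3) → K) :=
  Projectivization.lift
    (fun v => Projectivization.mk K (coneMap K k ε v) (coneMap_ne_zero k ε v.2)) <| by
      intro a b t hab
      rw [Projectivization.mk_eq_mk_iff']
      exact ⟨t ^ (2 * k + ε), by rw [← coneMap_smul, hab]⟩

/-- The surface `S_d ⊂ ℙ^(k+2)`, `d = 2k + ε`: the image of the morphism `φ`. -/
def surface (K : Type*) [Field K] (k ε : ℕ) : Set (ℙ K (Fin (k + 3) → K)) :=
  Set.range (morphism K k ε)

/-- The homogeneous ideal `I(S)` of a subset `S` of a projective space: the ideal generated by the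
homogeneous polynomials that vanish at all points of `S`. -/
def homogeneousIdeal {K : Type*} [Field K] {n : ℕ} (S : Set (ℙ K (Fin n → K))) :
    Ideal (MvPolynomial (Fin n) K) :=
  Ideal.span {f | (∃ e : ℕ, f.IsHomogeneous e) ∧
    ∀ (v : Fin n → K) (hv : v ≠ 0), Projectivization.mk K v hv ∈ S → eval v f = 0}

/-- The ideal `I_t(M)` generated by the `t × t` minors of the matrix `M`. -/
def minorsIdeal {R : Type*} [CommRing R] {m n : ℕ} (t : ℕ) (M : Matrix (Fin m) (Fin n) R) :
    Ideal R :=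
  Ideal.span (Set.range fun p : (Fin t ↪o Fin m) × (Fin t ↪o Fin n) =>
    (M.submatrix p.1 p.2).det)

/-- The sequence of indices `3, 4, …, k + 2, 2`. -/
def index (k : ℕ) (j : Fin (k + 1)) : Fin (k + 3) :=
  if h : (j : ℕ) < k then ⟨(j : ℕ) + 3, by omega⟩ else 2

/-- The `2 × k` matrix
```
x_3  x_4  …  x_{k+1}  x_{k+2}
x_4  x_5  …  x_{k+2}  x_2
``` -/
def matrixB (K : Type*) [Field K] (k : ℕ) :
    Matrix (Fin 2) (Fin k) (MvPolynomial (Fin (k + 3)) K) :=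
  Matrix.of ![fun j => X (index k j.castSucc), fun j => X (index k j.succ)]

/-- The `2 × (k + 1)` matrix (for `1 ≤ k`)
```
x_3  x_4  …  x_{k+1}  x_{k+2}  x_0 x_1
x_4  x_5  …  x_{k+2}  x_2      x_3 ^ 2
``` -/
def matrixA (K : Type*) [Field K] (k : ℕ) :
    Matrix (Fin 2) (Fin (k + 1)) (MvPolynomial (Fin (k + 3)) K) :=
  Matrix.of ![Fin.snoc (α := fun _ => MvPolynomial (Fin (k + 3)) K) (matrixB K k 0) (X 0 * X 1),
    Fin.snoc (α := fun _ => MvPolynomial (Fin (k + 3)) K) (matrixB K k 1) (X 3 ^ 2)]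

end GTSurface

end

/-! As `K` is infinite, `I(S_d)` is generated by the homogeneous elements of the kernel of the toric
map sending `x_i` to the `i`-th generator. Monomials go to monomials, so the kernel lies in an ideal
`J` as soon as monomials with equal image are congruent mod `J` (`mem_of_aeval_eq_zero`).

Write `y_j = x_{j+3}` for `j < k` and `y_k = x_2`; the image of `y_j` is `(xy)^(k-j) z^(ε+2j)`.
Modulo the minors of the rational normal curve, a product of `n` of the `y_j` depends only on `n`
and the index sum `s` (`mul_curveNF`). Every monomial is thus congruent to `x_0^p x_1^q` times a
normal form `(n, s)`, with image exponents `dp + c`, `dq + c`, `εn + 2s`, where `c = kn - s`.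

Equal images force `p - p' = q - q' = e`, say with `e ≥ 0`, and then `n' = n + 2e`, `s = s' + εe`.
For `ε = 0` the quadric turns `(x_0 x_1)^e` into `y_0^(2e)`; for `ε = 1` the cubics `y_j y_0^2 = x_0
x_1 y_{j+1}` absorb one factor `x_0 x_1` at a time, each lowering `s` by one. -/

noncomputable section

namespace GTSurface

/-! ### Normal forms modulo the rational normal curve -/

section NormalForm

variable {A : Type*} [CommRing A]

/-- The normal form of a product of `n` of the elements `y 0, …, y k` with index sum `s`, modulo the
equations of the rational normal curve. -/
def curveNF (k : ℕ) (y : ℕ → A) : ℕ → ℕ → A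
  | 0, _ => 1
  | n + 1, s => if s ≤ k then y s * y 0 ^ n else y k * curveNF k y n (s - k)

variable {k : ℕ} {y : ℕ → A}

/-- The exchange relation moves one unit of index from `y j` to `y i` until the former is `y 0`. -/
theorem mul_eq_mul_zero (h : ∀ i j, i < k → j < k → y i * y (j + 1) = y (i + 1) * y j) :
    ∀ i j, i + j ≤ k → y j * y i = y (i + j) * y 0
  | i, 0, _ => by rw [add_zero, mul_comm]
  | i, j + 1, hij => by
    rw [mul_comm, h i j (by omega) (by omega), mul_comm,
      mul_eq_mul_zero h (i + 1) j (by omega)]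
    congr 2; omega

/-- The same exchange, stopped when the growing index reaches `k`; `m` counts the remaining moves.
-/
theorem mul_eq_mul_top (h : ∀ i j, i < k → j < k → y i * y (j + 1) = y (i + 1) * y j) :
    ∀ m i j, i + m = k → j ≤ k → k ≤ i + j → y j * y i = y k * y (i + j - k)
  | 0, i, j, hi, _, _ => by
    obtain rfl : i = k := by omega
    rw [mul_comm, Nat.add_sub_cancel_left]
  | m + 1, i, j + 1, hi, hj, hij => by
    rw [mul_comm, h i j (by omega) (by omega), mul_comm,
      mul_eq_mul_top h m (i + 1) j (by omega) (by omega) (by omega)]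
    congr 2; omega
  | m + 1, i, 0, hi, hj, hij => by omega

theorem mul_curveNF (h : ∀ i j, i < k → j < k → y i * y (j + 1) = y (i + 1) * y j) :
    ∀ n s j, j ≤ k → s ≤ k * n → y j * curveNF k y n s = curveNF k y (n + 1) (s + j)
  | 0, s, j, hj, hs => by
    obtain rfl : s = 0 := by simpa using hs
    simp [curveNF, hj]
  | n + 1, s, j, hj, hs => by
    by_cases hsk : s ≤ k
    · by_cases hsj : s + j ≤ k
      · rw [curveNF, if_pos hsk, curveNF, if_pos hsj, ← mul_assoc, mul_eq_mul_zero h s j hsj,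
          pow_succ]
        ring
      · rw [curveNF, if_pos hsk, curveNF, if_neg hsj, curveNF, if_pos (by omega), ← mul_assoc,
          mul_eq_mul_top h (k - s) s j (by omega) hj (by omega), mul_assoc]
    · have hs' : s - k ≤ k * n := by
        rw [mul_add, mul_one] at hs
        omega
      rw [curveNF, if_neg hsk, curveNF, if_neg (by omega), mul_left_comm,
        mul_curveNF h n (s - k) j hj hs']
      congr 2; omega

theorem sq_pow_mul_curveNF (h : ∀ i j, i < k → j < k → y i * y (j + 1) = y (i + 1) * y j)
    (n s : ℕ) (hs : s ≤ k * n) (e : ℕ) :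
    (y 0 ^ 2) ^ e * curveNF k y n s = curveNF k y (n + 2 * e) s := by
  induction e with
  | zero => simp
  | succ e ih =>
    have h1 : s ≤ k * (n + 2 * e) := hs.trans (Nat.mul_le_mul_left _ (by omega))
    have h2 : s ≤ k * (n + 2 * e + 1) := hs.trans (Nat.mul_le_mul_left _ (by omega))
    have e1 := mul_curveNF h _ _ 0 (Nat.zero_le _) h1
    have e2 := mul_curveNF h _ _ 0 (Nat.zero_le _) h2
    rw [pow_succ, mul_right_comm, ih, mul_comm, sq, mul_assoc, e1, add_zero, e2]
    rfl

/-- One factor `y (j + 1)` of the normal form absorbs `t` and becomes `y j * y 0 ^ 2`; `mul_curveNF`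
then restores the normal form. -/
theorem mul_curveNF_of_mul_eq (h : ∀ i j, i < k → j < k → y i * y (j + 1) = y (i + 1) * y j)
    {t : A} (ht : ∀ j, j < k → y j * y 0 ^ 2 = t * y (j + 1)) (n s : ℕ) (hs : s + 1 ≤ k * n) :
    t * curveNF k y n (s + 1) = curveNF k y (n + 2) s := by
  cases n with
  | zero => simp at hs
  | succ n =>
    rw [curveNF]
    split_ifs with hsk
    · rw [← mul_assoc, ← ht s (by omega), curveNF, if_pos (by omega)]
      ring
    -- The leading factor is now `y k`, written `y (l + 1)` so that `ht` applies at `l`.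
    · obtain ⟨l, rfl⟩ : ∃ l, k = l + 1 := ⟨k - 1, by
        rcases k with _ | k
        · simp at hs
        · simp⟩
      have hs' : s + 1 - (l + 1) ≤ (l + 1) * n := by
        rw [mul_add, mul_one] at hs
        omega
      have hs'' : s ≤ (l + 1) * (n + 1) := by omega
      have e1 := mul_curveNF h _ _ l (by omega) hs'
      have e2 : s + 1 - (l + 1) + l = s := by omega
      rw [e2] at e1
      have e3 := mul_curveNF h _ _ 0 (Nat.zero_le _) hs''
      have e4 := mul_curveNF h (n + 1 + 1) s 0 (Nat.zero_le _)
        (hs''.trans (Nat.mul_le_mul_left _ (by omega)))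
      rw [← mul_assoc, ← ht l (by omega), mul_right_comm, e1, mul_comm, sq, mul_assoc, e3,
        add_zero, e4]
      rfl

theorem pow_mul_curveNF_of_mul_eq
    (h : ∀ i j, i < k → j < k → y i * y (j + 1) = y (i + 1) * y j)
    {t : A} (ht : ∀ j, j < k → y j * y 0 ^ 2 = t * y (j + 1)) (e : ℕ) :
    ∀ n s : ℕ, s + e ≤ k * n → t ^ e * curveNF k y n (s + e) = curveNF k y (n + 2 * e) s := by
  induction e with
  | zero => simp
  | succ e ih =>
    intro n s hs
    have h2 : k * n ≤ k * (n + 2) := Nat.mul_le_mul_left _ (by omega)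
    rw [pow_succ, mul_assoc, ← add_assoc, mul_curveNF_of_mul_eq h ht _ _ (by omega),
      ih _ _ (by omega)]
    congr 1; ring

end NormalForm

/-! ### Kernels of monomial maps -/

section Kernel

variable {K : Type*} [Field K]

/-- The linear map `L` sends each monomial in the image to the class of a chosen preimage, and the
others to zero. By `hJ` the choice is immaterial, so the quotient map factors through `aeval g`. -/
theorem mem_of_aeval_eq_zero {σ τ : Type*} (g : σ → MvPolynomial τ K)
    (J : Ideal (MvPolynomial σ K))
    (hg : ∀ a : σ →₀ ℕ, ∃ m, aeval g (monomial a (1 : K)) = monomial m (1 : K))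
    (hJ : ∀ a b : σ →₀ ℕ, aeval g (monomial a (1 : K)) = aeval g (monomial b (1 : K)) →
      Ideal.Quotient.mk J (monomial a 1) = Ideal.Quotient.mk J (monomial b 1))
    {f : MvPolynomial σ K} (hf : aeval g f = 0) : f ∈ J := by
  classical
  let L : MvPolynomial τ K →ₗ[K] (MvPolynomial σ K ⧸ J) :=
    (basisMonomials τ K).constr K fun m =>
      if h : ∃ a : σ →₀ ℕ, aeval g (monomial a (1 : K)) = monomial m (1 : K) then
        Ideal.Quotient.mk J (monomial h.choose 1) else 0
  have hL : L ∘ₗ (aeval g).toLinearMap = (Ideal.Quotient.mkₐ K J).toLinearMap := by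
    refine (basisMonomials σ K).ext fun a => ?_
    obtain ⟨m, hm⟩ := hg a
    have hex : ∃ a : σ →₀ ℕ, aeval g (monomial a (1 : K)) = monomial m (1 : K) := ⟨a, hm⟩
    have h1 : L (monomial m 1) = Ideal.Quotient.mk J (monomial hex.choose 1) := by
      have := (basisMonomials τ K).constr_basis K (fun m =>
        if h : ∃ a : σ →₀ ℕ, aeval g (monomial a (1 : K)) = monomial m (1 : K) then
          Ideal.Quotient.mk J (monomial h.choose 1) else 0) m
      rw [coe_basisMonomials, dif_pos hex] at this
      exact this
    simp only [coe_basisMonomials, LinearMap.comp_apply, AlgHom.toLinearMap_apply, hm, h1]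
    exact hJ _ _ (hex.choose_spec.trans hm.symm)
  have := LinearMap.congr_fun hL f
  simp only [LinearMap.comp_apply, AlgHom.toLinearMap_apply, hf, map_zero] at this
  exact Ideal.Quotient.eq_zero_iff_mem.mp this.symm

variable (K) in
/-- The coordinates `x_3, …, x_{k+2}, x_2` of the rational normal curve. -/
def curveCoord (k j : ℕ) : MvPolynomial (Fin (k + 3)) K :=
  if h : j < k then X ⟨j + 3, by omega⟩ else X 2

theorem X_index (k : ℕ) (j : Fin (k + 1)) :
    (X (index k j) : MvPolynomial (Fin (k + 3)) K) = curveCoord K k j := by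
  unfold index curveCoord
  split_ifs <;> rfl

/-- The numeral `3` in `Fin (k + 3)` is reduced modulo `k + 3`, whence `1 ≤ k`. -/
theorem X_three (k : ℕ) (hk : 1 ≤ k) :
    (X 3 : MvPolynomial (Fin (k + 3)) K) = curveCoord K k 0 := by
  rw [curveCoord, dif_pos (by omega)]
  congr 1
  ext
  exact Nat.mod_eq_of_lt (show 3 < k + 3 by omega)

theorem exists_X_eq (k : ℕ) (i : Fin (k + 3)) :
    i = 0 ∨ i = 1 ∨ ∃ j ≤ k, (X i : MvPolynomial (Fin (k + 3)) K) = curveCoord K k j := by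
  obtain ⟨i, hi⟩ := i
  rcases i with _ | _ | _ | i
  · exact Or.inl rfl
  · exact Or.inr (Or.inl (by ext; simp))
  · refine Or.inr (Or.inr ⟨k, le_rfl, ?_⟩)
    rw [curveCoord, dif_neg (lt_irrefl k)]
    congr 1
  · refine Or.inr (Or.inr ⟨i, by omega, ?_⟩)
    rw [curveCoord, dif_pos (by omega)]

theorem generator_zero (k ε : ℕ) : generator K k ε 0 = X 0 ^ (2 * k + ε) := rfl

theorem generator_one (k ε : ℕ) : generator K k ε 1 = X 1 ^ (2 * k + ε) := rfl

theorem generator_two (k ε : ℕ) : generator K k ε 2 = X 2 ^ (2 * k + ε) := rfl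

theorem aeval_curveCoord (k ε j : ℕ) (hj : j ≤ k) :
    aeval (generator K k ε) (curveCoord K k j)
      = X 0 ^ (k - j) * X 1 ^ (k - j) * X 2 ^ (ε + 2 * j) := by
  unfold curveCoord
  split_ifs with h
  · rw [aeval_X]; rfl
  · obtain rfl : j = k := by omega
    rw [aeval_X, generator_two]
    simp [add_comm]

theorem X_pow_mul_eq_monomial (a b c : ℕ) :
    (X 0 ^ a * X 1 ^ b * X 2 ^ c : MvPolynomial (Fin 3) K)
      = monomial (Finsupp.single 0 a + Finsupp.single 1 b + Finsupp.single 2 c) 1 := by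
  simp [X_pow_eq_monomial, monomial_mul]

theorem X_pow_mul_injective {a b c a' b' c' : ℕ}
    (h : (X 0 ^ a * X 1 ^ b * X 2 ^ c : MvPolynomial (Fin 3) K)
      = X 0 ^ a' * X 1 ^ b' * X 2 ^ c') : a = a' ∧ b = b' ∧ c = c' := by
  rw [X_pow_mul_eq_monomial, X_pow_mul_eq_monomial] at h
  have h' := monomial_left_injective (one_ne_zero (α := K)) h
  exact ⟨by simpa using DFunLike.congr_fun h' 0, by simpa using DFunLike.congr_fun h' 1,
    by simpa using DFunLike.congr_fun h' 2⟩

/-- The normal form of a monomial modulo an ideal `J` containing the equations of the rational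
normal curve, with its image under the parametrization. -/
theorem exists_normalForm (k ε : ℕ) (J : Ideal (MvPolynomial (Fin (k + 3)) K))
    (h : ∀ i j, i < k → j < k →
      Ideal.Quotient.mk J (curveCoord K k i) * Ideal.Quotient.mk J (curveCoord K k (j + 1))
        = Ideal.Quotient.mk J (curveCoord K k (i + 1)) * Ideal.Quotient.mk J (curveCoord K k j))
    (a : Fin (k + 3) →₀ ℕ) : ∃ p q n s c : ℕ, s + c = k * n ∧
      Ideal.Quotient.mk J (monomial a 1) = Ideal.Quotient.mk J (X 0) ^ p *
        Ideal.Quotient.mk J (X 1) ^ q *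
          curveNF k (fun j => Ideal.Quotient.mk J (curveCoord K k j)) n s ∧
      aeval (generator K k ε) (monomial a (1 : K))
        = X 0 ^ ((2 * k + ε) * p + c) * X 1 ^ ((2 * k + ε) * q + c) * X 2 ^ (ε * n + 2 * s) := by
  induction a using Finsupp.induction with
  | zero => exact ⟨0, 0, 0, 0, 0, by simp, by simp [curveNF], by simp⟩
  | single_add i b f _ _ ih =>
    clear * - ih h
    -- Peel off one variable at a time, so that each step is a single multiplication by some `X i`.
    induction b with
    | zero => simpa using ih
    | succ b ihb =>
      obtain ⟨p, q, n, s, c, hc, h1, h2⟩ := ihb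
      have e : monomial (Finsupp.single i (b + 1) + f) (1 : K)
          = X i * monomial (Finsupp.single i b + f) 1 := by
        rw [monomial_single_add, monomial_single_add, pow_succ', mul_assoc]
      rw [e, map_mul, map_mul, h1, h2]
      rcases exists_X_eq (K := K) k i with rfl | rfl | ⟨j, hj, hX⟩
      · refine ⟨p + 1, q, n, s, c, hc, by ring, ?_⟩
        rw [aeval_X, generator_zero]
        ring
      · refine ⟨p, q + 1, n, s, c, hc, by ring, ?_⟩
        rw [aeval_X, generator_one]
        ring
      · refine ⟨p, q, n + 1, s + j, c + (k - j), ?_, ?_, ?_⟩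
        · rw [mul_add]
          omega
        · rw [hX, ← mul_curveNF (y := fun j => Ideal.Quotient.mk J (curveCoord K k j)) h n s j hj
            (by omega)]
          ring
        · rw [hX, aeval_curveCoord k ε j hj]
          ring

end Kernel

/-! ### The ideal of the surface and the kernel -/

section Homogeneous

variable {K : Type*} [Field K]

theorem eval_coneMap (k ε : ℕ) (w : Fin 3 → K) (f : MvPolynomial (Fin (k + 3)) K) :
    eval (coneMap K k ε w) f = eval w (aeval (generator K k ε) f) := by
  induction f using MvPolynomial.induction_on with
  | C a => simp
  | add p q hp hq => simp [hp, hq]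
  | mul_X p i hp => rw [map_mul, map_mul, map_mul, hp, eval_X, aeval_X, coneMap]

theorem mk_coneMap_mem_surface (k ε : ℕ) {w : Fin 3 → K} (hw : w ≠ 0) :
    Projectivization.mk K (coneMap K k ε w) (coneMap_ne_zero k ε hw) ∈ surface K k ε :=
  ⟨Projectivization.mk K w hw, rfl⟩

theorem exists_smul_coneMap (k ε : ℕ) {v : Fin (k + 3) → K} (hv : v ≠ 0)
    (h : Projectivization.mk K v hv ∈ surface K k ε) :
    ∃ (t : K) (w : Fin 3 → K), v = t • coneMap K k ε w := by
  obtain ⟨p, hp⟩ := h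
  induction p using Projectivization.ind with
  | h w hw =>
    obtain ⟨t, ht⟩ := (Projectivization.mk_eq_mk_iff' K _ _ hv (coneMap_ne_zero k ε hw)).mp hp.symm
    exact ⟨t, w, ht.symm⟩

theorem homogeneousIdeal_surface_le [Infinite K] (k ε : ℕ)
    (J : Ideal (MvPolynomial (Fin (k + 3)) K))
    (hJ : ∀ f, aeval (generator K k ε) f = 0 → f ∈ J) :
    homogeneousIdeal (surface K k ε) ≤ J := by
  refine Ideal.span_le.mpr ?_
  rintro f ⟨-, hf⟩
  refine hJ f ?_
  -- The origin gives no projective point; the factor `X 0` makes the product vanish there, and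
  -- cancels afterwards.
  have h0 : (X 0 : MvPolynomial (Fin 3) K) * aeval (generator K k ε) f = 0 := by
    refine MvPolynomial.funext fun w => ?_
    rw [map_mul, eval_X, map_zero]
    by_cases hw : w 0 = 0
    · rw [hw, zero_mul]
    · have hw' : w ≠ 0 := fun h => hw (by rw [h]; rfl)
      rw [← eval_coneMap, hf _ _ (mk_coneMap_mem_surface k ε hw'), mul_zero]
  exact (mul_eq_zero.mp h0).resolve_left (X_ne_zero 0)

theorem eval_smul_of_isHomogeneous {σ : Type*} {e : ℕ} {f : MvPolynomial σ K}
    (he : f.IsHomogeneous e) (t : K) (v : σ → K) : eval (t • v) f = t ^ e * eval v f := by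
  rw [eval_eq, eval_eq, Finset.mul_sum]
  refine Finset.sum_congr rfl fun d hd => ?_
  have hdeg : ∑ i ∈ d.support, d i = e := by
    rw [← he.degree_eq_sum_deg_support hd]
  simp only [Pi.smul_apply, smul_eq_mul, mul_pow]
  rw [Finset.prod_mul_distrib, Finset.prod_pow_eq_pow_sum, hdeg]
  ring

theorem mem_homogeneousIdeal_surface {k ε e : ℕ} {f : MvPolynomial (Fin (k + 3)) K}
    (he : f.IsHomogeneous e) (hf : aeval (generator K k ε) f = 0) :
    f ∈ homogeneousIdeal (surface K k ε) := by
  refine Ideal.subset_span ⟨⟨e, he⟩, fun v hv h => ?_⟩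
  obtain ⟨t, w, rfl⟩ := exists_smul_coneMap k ε hv h
  rw [eval_smul_of_isHomogeneous he, eval_coneMap, hf, map_zero, mul_zero]

end Homogeneous

/-! ### The equations, the minors and their distinctness -/

section Equations

variable (K : Type*) [Field K]

/-- The quadric `y_i y_{j+1} - y_{i+1} y_j` through the rational normal curve. -/
def curveMinor (k i j : ℕ) : MvPolynomial (Fin (k + 3)) K :=
  curveCoord K k i * curveCoord K k (j + 1) - curveCoord K k j * curveCoord K k (i + 1)

/-- The cubic `y_j y_0 ^ 2 - x_0 x_1 y_{j+1}`. -/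
def surfaceCubic (k j : ℕ) : MvPolynomial (Fin (k + 3)) K :=
  curveCoord K k j * curveCoord K k 0 ^ 2 - X 0 * X 1 * curveCoord K k (j + 1)

open Classical in
/-- The `2 × 2` minors of the catalecticant matrix of the rational normal curve. -/
def curveMinors (k : ℕ) : Finset (MvPolynomial (Fin (k + 3)) K) :=
  ((Finset.range k).sigma Finset.range).image fun p => curveMinor K k p.2 p.1

open Classical in
/-- The cubics `y_j y_0 ^ 2 - x_0 x_1 y_{j+1}`, `j < k`. -/
def surfaceCubics (k : ℕ) : Finset (MvPolynomial (Fin (k + 3)) K) :=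
  (Finset.range k).image (surfaceCubic K k)

variable {K}

theorem mem_curveMinors {k : ℕ} {f : MvPolynomial (Fin (k + 3)) K} :
    f ∈ curveMinors K k ↔ ∃ i j, i < j ∧ j < k ∧ curveMinor K k i j = f := by
  simp only [curveMinors, Finset.mem_image, Finset.mem_sigma, Finset.mem_range, Sigma.exists]
  constructor
  · rintro ⟨j, i, ⟨hj, hi⟩, rfl⟩
    exact ⟨i, j, hi, hj, rfl⟩
  · rintro ⟨i, j, hi, hj, rfl⟩
    exact ⟨j, i, ⟨hj, hi⟩, rfl⟩

theorem mem_surfaceCubics {k : ℕ} {f : MvPolynomial (Fin (k + 3)) K} :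
    f ∈ surfaceCubics K k ↔ ∃ j < k, surfaceCubic K k j = f := by
  simp [surfaceCubics]

theorem isHomogeneous_curveCoord (k j : ℕ) : (curveCoord K k j).IsHomogeneous 1 := by
  unfold curveCoord
  split_ifs <;> exact isHomogeneous_X _ _

theorem isHomogeneous_curveMinor (k i j : ℕ) : (curveMinor K k i j).IsHomogeneous 2 :=
  ((isHomogeneous_curveCoord k _).mul (isHomogeneous_curveCoord k _)).sub
    ((isHomogeneous_curveCoord k _).mul (isHomogeneous_curveCoord k _))

theorem isHomogeneous_surfaceCubic (k j : ℕ) : (surfaceCubic K k j).IsHomogeneous 3 :=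
  ((isHomogeneous_curveCoord k _).mul ((isHomogeneous_curveCoord k _).pow 2)).sub
    (((isHomogeneous_X _ _).mul (isHomogeneous_X _ _)).mul (isHomogeneous_curveCoord k _))

theorem aeval_curveMinor {k i j : ℕ} (ε : ℕ) (hij : i < j) (hj : j < k) :
    aeval (generator K k ε) (curveMinor K k i j) = 0 := by
  -- Writing `j` and `k` as sums turns the truncated exponents `k - j` into polynomial expressions
  -- for `ring`.
  obtain ⟨m, rfl⟩ := Nat.exists_eq_add_of_lt hj
  obtain ⟨l, rfl⟩ := Nat.exists_eq_add_of_lt hij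
  simp only [curveMinor, map_sub, map_mul]
  rw [aeval_curveCoord _ _ _ (by omega), aeval_curveCoord _ _ _ (by omega),
    aeval_curveCoord _ _ _ (by omega), aeval_curveCoord _ _ _ (by omega)]
  have e1 : i + l + 1 + m + 1 - i = l + m + 2 := by omega
  have e2 : i + l + 1 + m + 1 - (i + l + 1 + 1) = m := by omega
  have e3 : i + l + 1 + m + 1 - (i + l + 1) = m + 1 := by omega
  have e4 : i + l + 1 + m + 1 - (i + 1) = l + m + 1 := by omega
  rw [e1, e2, e3, e4]
  ring

theorem aeval_surfaceCubic {k j : ℕ} (hj : j < k) :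
    aeval (generator K k 1) (surfaceCubic K k j) = 0 := by
  obtain ⟨m, rfl⟩ := Nat.exists_eq_add_of_lt hj
  simp only [surfaceCubic, map_sub, map_mul, map_pow]
  rw [aeval_curveCoord _ _ _ (by omega), aeval_curveCoord _ _ _ (by omega),
    aeval_curveCoord _ _ _ (by omega), aeval_X, aeval_X, generator_zero, generator_one]
  have e1 : j + m + 1 - j = m + 1 := by omega
  have e2 : j + m + 1 - (j + 1) = m := by omega
  rw [e1, e2, Nat.sub_zero]
  ring

theorem aeval_quadric (k : ℕ) :
    aeval (generator K k 0) (X 0 * X 1 - curveCoord K k 0 ^ 2) = 0 := by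
  simp only [map_sub, map_mul, map_pow]
  rw [aeval_curveCoord _ _ _ (by omega), aeval_X, aeval_X, generator_zero, generator_one]
  rw [Nat.sub_zero]
  ring

theorem minorsIdeal_two {R : Type*} [CommRing R] {n : ℕ} (M : Matrix (Fin 2) (Fin n) R) :
    minorsIdeal 2 M = Ideal.span {f | ∃ i j, i < j ∧ M 0 i * M 1 j - M 0 j * M 1 i = f} := by
  unfold minorsIdeal
  congr 1
  ext f
  simp only [Set.mem_range, Prod.exists, Matrix.det_fin_two, Matrix.submatrix_apply,
    Set.mem_ofPred_eq]
  have key : ∀ r : Fin 2 ↪o Fin 2, r 0 = 0 ∧ r 1 = 1 := by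
    intro r
    have : r 0 < r 1 := r.strictMono (by decide)
    omega
  constructor
  · rintro ⟨r, c, rfl⟩
    refine ⟨c 0, c 1, c.strictMono (by decide), ?_⟩
    rw [(key r).1, (key r).2]
  · rintro ⟨i, j, hij, rfl⟩
    refine ⟨RelEmbedding.refl _, OrderEmbedding.ofStrictMono ![i, j] ?_, ?_⟩
    · intro a b hab
      obtain ⟨rfl, rfl⟩ : a = 0 ∧ b = 1 := by omega
      simpa using hij
    · rfl

theorem matrixB_zero (k : ℕ) (j : Fin k) : matrixB K k 0 j = curveCoord K k j := by
  simp [matrixB, X_index]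

theorem matrixB_one (k : ℕ) (j : Fin k) : matrixB K k 1 j = curveCoord K k (j + 1) := by
  simp [matrixB, X_index]

theorem minorsIdeal_matrixB (k : ℕ) :
    minorsIdeal 2 (matrixB K k) = Ideal.span (curveMinors K k) := by
  rw [minorsIdeal_two]
  congr 1
  ext f
  simp only [Set.mem_ofPred_eq, Finset.mem_coe, mem_curveMinors, matrixB_zero, matrixB_one]
  constructor
  · rintro ⟨i, j, hij, rfl⟩
    exact ⟨i, j, hij, j.2, rfl⟩
  · rintro ⟨i, j, hij, hj, rfl⟩
    exact ⟨⟨i, hij.trans hj⟩, ⟨j, hj⟩, hij, rfl⟩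

theorem minorsIdeal_matrixA (k : ℕ) (hk : 1 ≤ k) :
    minorsIdeal 2 (matrixA K k)
      = Ideal.span ((curveMinors K k : Set (MvPolynomial (Fin (k + 3)) K)) ∪
          surfaceCubics K k) := by
  rw [minorsIdeal_two]
  congr 1
  ext f
  have h0 : ∀ j : Fin k, matrixA K k 0 j.castSucc = curveCoord K k j := fun j => by
    simp [matrixA, matrixB_zero]
  have h1 : ∀ j : Fin k, matrixA K k 1 j.castSucc = curveCoord K k (j + 1) := fun j => by
    simp [matrixA, matrixB_one]
  have h2 : matrixA K k 0 (Fin.last k) = X 0 * X 1 := by simp [matrixA]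
  have h3 : matrixA K k 1 (Fin.last k) = curveCoord K k 0 ^ 2 := by
    simp [matrixA, X_three k hk]
  simp only [Set.mem_ofPred_eq, Set.mem_union, Finset.mem_coe, mem_curveMinors, mem_surfaceCubics]
  constructor
  · rintro ⟨i, j, hij, rfl⟩
    have hi : i ≠ Fin.last k := (hij.trans_le (Fin.le_last j)).ne
    obtain ⟨i, rfl⟩ := Fin.exists_castSucc_eq.mpr hi
    induction j using Fin.lastCases with
    | last => exact Or.inr ⟨i, i.2, by rw [h0, h1, h2, h3]; rfl⟩
    | cast j => exact Or.inl ⟨i, j, hij, j.2, by rw [h0, h1, h0, h1]; rfl⟩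
  · rintro (⟨i, j, hij, hj, rfl⟩ | ⟨j, hj, rfl⟩)
    · exact ⟨Fin.castSucc ⟨i, hij.trans hj⟩, Fin.castSucc ⟨j, hj⟩, hij, by
        rw [h0, h1, h0, h1]; rfl⟩
    · exact ⟨Fin.castSucc ⟨j, hj⟩, Fin.last k, Fin.castSucc_lt_last _, by
        rw [h0, h1, h2, h3]; rfl⟩

/-- The point with `x_0 = a`, `x_1 = b` and `y_j = u j` for `j ≤ k`. -/
def curvePoint (k : ℕ) (a b : K) (u : ℕ → K) : Fin (k + 3) → K :=
  Matrix.vecCons a <| Matrix.vecCons b <| Matrix.vecCons (u k) fun j : Fin k => u j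

theorem eval_curvePoint_curveCoord {k j : ℕ} (a b : K) (u : ℕ → K) (hj : j ≤ k) :
    eval (curvePoint k a b u) (curveCoord K k j) = u j := by
  unfold curveCoord
  split_ifs with h
  · rw [eval_X]; rfl
  · obtain rfl : j = k := by omega
    rw [eval_X]; rfl

theorem eval_curvePoint_curveMinor {k i j : ℕ} (a b : K) (u : ℕ → K) (hij : i < j) (hj : j < k) :
    eval (curvePoint k a b u) (curveMinor K k i j) = u i * u (j + 1) - u j * u (i + 1) := by
  simp only [curveMinor, map_sub, map_mul]
  rw [eval_curvePoint_curveCoord _ _ _ (by omega), eval_curvePoint_curveCoord _ _ _ (by omega),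
    eval_curvePoint_curveCoord _ _ _ (by omega), eval_curvePoint_curveCoord _ _ _ (by omega)]

theorem eval_curvePoint_surfaceCubic {k j : ℕ} (a b : K) (u : ℕ → K) (hj : j < k) :
    eval (curvePoint k a b u) (surfaceCubic K k j) = u j * u 0 ^ 2 - a * b * u (j + 1) := by
  simp only [surfaceCubic, map_sub, map_mul, map_pow, eval_X]
  rw [eval_curvePoint_curveCoord _ _ _ (by omega), eval_curvePoint_curveCoord _ _ _ (by omega),
    eval_curvePoint_curveCoord _ _ _ (by omega)]
  rfl

theorem eval_curveMinor_eq_one {k i j : ℕ} (hij : i < j) (hj : j < k) :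
    eval (curvePoint k 0 0 fun m => if m = i ∨ m = j + 1 then (1 : K) else 0)
      (curveMinor K k i j) = 1 := by
  rw [eval_curvePoint_curveMinor _ _ _ hij hj, if_pos (Or.inl rfl), if_pos (Or.inr rfl),
    if_neg (by omega)]
  simp

/-- At the point with only `y_i = y_{j+1} = 1`, the positive term of a minor survives only for the
pair `(i, j)`; any other minor takes the value `0` or `-1`, which differs from `1` in characteristic
zero. -/
theorem eq_of_eval_curveMinor_eq_one [CharZero K] {k i j i' j' : ℕ} (hij : i < j)
    (hij' : i' < j') (hj' : j' < k)
    (h : eval (curvePoint k 0 0 fun m => if m = i ∨ m = j + 1 then (1 : K) else 0)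
      (curveMinor K k i' j') = 1) : i = i' ∧ j = j' := by
  rw [eval_curvePoint_curveMinor _ _ _ hij' hj'] at h
  have hne : (-1 : K) ≠ 1 := by norm_num
  by_contra hne'
  have h1 : ¬ ((i' = i ∨ i' = j + 1) ∧ (j' + 1 = i ∨ j' + 1 = j + 1)) := by omega
  split_ifs at h <;> simp_all

/-- The test point has `y_0 = 0`, so only the term `-x_0 x_1 y_{j'+1}` contributes; it separates the
cubics. -/
theorem surfaceCubic_eval_eq {k j j' : ℕ} (hj' : j' < k) :
    eval (curvePoint k 1 1 fun m => if m = j + 1 then (1 : K) else 0)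
      (surfaceCubic K k j') = if j' = j then -1 else 0 := by
  rw [eval_curvePoint_surfaceCubic _ _ _ hj']
  split_ifs <;> simp_all

theorem card_curveMinors [CharZero K] (k : ℕ) : (curveMinors K k).card = k.choose 2 := by
  classical
  rw [curveMinors, Finset.card_image_of_injOn, Finset.card_sigma]
  · simp only [Finset.card_range]
    rw [Finset.sum_range_id, Nat.choose_two_right]
  · rintro ⟨j, i⟩ h ⟨j', i'⟩ h' heq
    simp only [Finset.coe_sigma, Set.mem_sigma_iff, Finset.mem_coe, Finset.mem_range] at h h' heq
    obtain ⟨rfl, rfl⟩ := eq_of_eval_curveMinor_eq_one (K := K) h.2 h'.2 h'.1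
      (heq ▸ eval_curveMinor_eq_one h.2 h.1)
    rfl

theorem card_surfaceCubics (k : ℕ) : (surfaceCubics K k).card = k := by
  classical
  rw [surfaceCubics, Finset.card_image_of_injOn, Finset.card_range]
  intro j hj j' hj' heq
  simp only [Finset.coe_range, Set.mem_Iio] at hj hj'
  have h := congrArg
    (eval (curvePoint k 1 1 fun m => if m = j + 1 then (1 : K) else 0)) heq
  rw [surfaceCubic_eval_eq hj, surfaceCubic_eval_eq hj', if_pos rfl] at h
  by_contra hne
  rw [if_neg (Ne.symm hne)] at h
  simp at h

theorem curveMinor_ne_zero {k i j : ℕ} (hij : i < j) (hj : j < k) : curveMinor K k i j ≠ 0 :=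
  fun h => by simpa [h] using eval_curveMinor_eq_one (K := K) hij hj

theorem surfaceCubic_ne_zero {k j : ℕ} (hj : j < k) : surfaceCubic K k j ≠ 0 :=
  fun h => by simpa [h] using surfaceCubic_eval_eq (K := K) (j := j) hj

theorem eval_quadric (k : ℕ) :
    eval (curvePoint k 1 1 fun _ => 0) (X 0 * X 1 - curveCoord K k 0 ^ 2) = (1 : K) := by
  simp only [map_sub, map_mul, map_pow, eval_X]
  rw [eval_curvePoint_curveCoord _ _ _ (by omega)]
  simp [curvePoint]

theorem quadric_notMem_curveMinors (k : ℕ) :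
    (X 0 * X 1 - curveCoord K k 0 ^ 2) ∉ curveMinors K k := by
  rw [mem_curveMinors]
  rintro ⟨i, j, hij, hj, h⟩
  have := eval_quadric (K := K) k
  rw [← h, eval_curvePoint_curveMinor _ _ _ hij hj] at this
  simp at this

end Equations

/-! ### The ideals in the odd and even cases -/

section Ideals

variable {K : Type*} [Field K]

theorem mk_mul_mk_of_curveMinors_subset {k : ℕ} {J : Ideal (MvPolynomial (Fin (k + 3)) K)}
    (hJ : ∀ i j, i < j → j < k → curveMinor K k i j ∈ J) (i j : ℕ) (hi : i < k) (hj : j < k) :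
    Ideal.Quotient.mk J (curveCoord K k i) * Ideal.Quotient.mk J (curveCoord K k (j + 1))
      = Ideal.Quotient.mk J (curveCoord K k (i + 1)) * Ideal.Quotient.mk J (curveCoord K k j) := by
  rcases lt_trichotomy i j with hij | rfl | hij
  · have := Ideal.Quotient.eq_zero_iff_mem.mpr (hJ i j hij hj)
    simp only [curveMinor, map_sub, map_mul] at this
    rw [sub_eq_zero.mp this, mul_comm]
  · rw [mul_comm]
  · have := Ideal.Quotient.eq_zero_iff_mem.mpr (hJ j i hij hi)
    simp only [curveMinor, map_sub, map_mul] at this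
    rw [← sub_eq_zero.mp this, mul_comm]

/-- Reduces both parities to `hcong`: once the common powers of `x_0` and `x_1` are removed, only a
factor `(x_0 x_1)^e` on one side remains. -/
theorem mem_of_aeval_generator_eq_zero {k ε : ℕ} (hk : 1 ≤ k)
    {J : Ideal (MvPolynomial (Fin (k + 3)) K)}
    (hJ : ∀ i j, i < j → j < k → curveMinor K k i j ∈ J)
    (hcong : ∀ e n n' s s' : ℕ, s ≤ k * n → s' ≤ k * n' →
      (2 * k + ε) * e + (k * n - s) = k * n' - s' → ε * n + 2 * s = ε * n' + 2 * s' →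
      (Ideal.Quotient.mk J (X 0) * Ideal.Quotient.mk J (X 1)) ^ e *
          curveNF k (fun j => Ideal.Quotient.mk J (curveCoord K k j)) n s
        = curveNF k (fun j => Ideal.Quotient.mk J (curveCoord K k j)) n' s')
    {f : MvPolynomial (Fin (k + 3)) K} (hf : aeval (generator K k ε) f = 0) : f ∈ J := by
  have h := mk_mul_mk_of_curveMinors_subset hJ
  refine mem_of_aeval_eq_zero (generator K k ε) J (fun a => ?_) (fun a b hab => ?_) hf
  · obtain ⟨p, q, n, s, c, -, -, h2⟩ := exists_normalForm k ε J h a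
    exact ⟨_, h2.trans (X_pow_mul_eq_monomial _ _ _)⟩
  · obtain ⟨p, q, n, s, c, hc, h1, h2⟩ := exists_normalForm k ε J h a
    obtain ⟨p', q', n', s', c', hc', h1', h2'⟩ := exists_normalForm k ε J h b
    obtain ⟨e1, e2, e3⟩ := X_pow_mul_injective (h2.symm.trans (hab.trans h2'))
    -- The situation is symmetric in the two monomials, so `p' ≤ p` may be assumed.
    have key : ∀ p q n s c p' q' n' s' c' : ℕ, s + c = k * n → s' + c' = k * n' → p' ≤ p →
        (2 * k + ε) * p + c = (2 * k + ε) * p' + c' →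
        (2 * k + ε) * q + c = (2 * k + ε) * q' + c' → ε * n + 2 * s = ε * n' + 2 * s' →
        Ideal.Quotient.mk J (X 0) ^ p * Ideal.Quotient.mk J (X 1) ^ q *
          curveNF k (fun j => Ideal.Quotient.mk J (curveCoord K k j)) n s
        = Ideal.Quotient.mk J (X 0) ^ p' * Ideal.Quotient.mk J (X 1) ^ q' *
          curveNF k (fun j => Ideal.Quotient.mk J (curveCoord K k j)) n' s' := by
      clear * - hcong hk
      intro p q n s c p' q' n' s' c' hc hc' hp e1 e2 e3
      obtain ⟨e, rfl⟩ := Nat.exists_eq_add_of_le hp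
      rw [mul_add] at e1
      obtain rfl : q = q' + e := by
        refine Nat.eq_of_mul_eq_mul_left (show 0 < 2 * k + ε by omega) ?_
        rw [mul_add]
        omega
      rw [← hcong e n n' s s' (by omega) (by omega) (by omega) e3]
      ring
    rw [h1, h1']
    rcases le_total p' p with hp | hp
    · exact key _ _ _ _ _ _ _ _ _ _ hc hc' hp e1 e2 e3
    · exact (key _ _ _ _ _ _ _ _ _ _ hc' hc hp e1.symm e2.symm e3.symm).symm

theorem homogeneousIdeal_surface_one [Infinite K] (k : ℕ) (hk : 1 ≤ k) :
    homogeneousIdeal (surface K k 1)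
      = Ideal.span ((curveMinors K k : Set (MvPolynomial (Fin (k + 3)) K)) ∪
          surfaceCubics K k) := by
  apply le_antisymm
  · refine homogeneousIdeal_surface_le k 1 _ fun f hf => ?_
    have hJ : ∀ i j, i < j → j < k → curveMinor K k i j ∈
        Ideal.span ((curveMinors K k : Set (MvPolynomial (Fin (k + 3)) K)) ∪
          surfaceCubics K k) :=
      fun i j hij hj => Ideal.subset_span (Or.inl (mem_curveMinors.mpr ⟨i, j, hij, hj, rfl⟩))
    refine mem_of_aeval_generator_eq_zero hk hJ (fun e n n' s s' hs hs' e1 e2 => ?_) hf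
    -- Twice `e1` plus `e2` eliminates `s` and `s'`, leaving a common factor `2k + 1`.
    have hn : n' = n + 2 * e := by
      have : (2 * k + 1) * n' = (2 * k + 1) * (n + 2 * e) := by
        simp only [add_mul, mul_add, one_mul, mul_assoc, mul_left_comm k 2] at e1 e2 ⊢
        omega
      exact Nat.eq_of_mul_eq_mul_left (by omega) this
    obtain rfl : s = s' + e := by omega
    subst hn
    refine pow_mul_curveNF_of_mul_eq (mk_mul_mk_of_curveMinors_subset hJ) (fun j hj => ?_) e n s' hs
    have := Ideal.Quotient.eq_zero_iff_mem.mpr (Ideal.subset_span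
      (s := (curveMinors K k : Set (MvPolynomial (Fin (k + 3)) K)) ∪ surfaceCubics K k)
      (Or.inr (mem_surfaceCubics.mpr ⟨j, hj, rfl⟩)))
    simp only [surfaceCubic, map_sub, map_mul, map_pow] at this
    exact sub_eq_zero.mp this
  · refine Ideal.span_le.mpr ?_
    rintro f (hf | hf)
    · obtain ⟨i, j, hij, hj, rfl⟩ := mem_curveMinors.mp hf
      exact mem_homogeneousIdeal_surface (isHomogeneous_curveMinor k i j)
        (aeval_curveMinor 1 hij hj)
    · obtain ⟨j, hj, rfl⟩ := mem_surfaceCubics.mp hf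
      exact mem_homogeneousIdeal_surface (isHomogeneous_surfaceCubic k j) (aeval_surfaceCubic hj)

theorem homogeneousIdeal_surface_zero [Infinite K] (k : ℕ) (hk : 1 ≤ k) :
    homogeneousIdeal (surface K k 0)
      = Ideal.span (insert (X 0 * X 1 - curveCoord K k 0 ^ 2)
          (curveMinors K k : Set (MvPolynomial (Fin (k + 3)) K))) := by
  apply le_antisymm
  · refine homogeneousIdeal_surface_le k 0 _ fun f hf => ?_
    have hJ : ∀ i j, i < j → j < k → curveMinor K k i j ∈
        Ideal.span (insert (X 0 * X 1 - curveCoord K k 0 ^ 2)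
          (curveMinors K k : Set (MvPolynomial (Fin (k + 3)) K))) :=
      fun i j hij hj => Ideal.subset_span (Or.inr (mem_curveMinors.mpr ⟨i, j, hij, hj, rfl⟩))
    refine mem_of_aeval_generator_eq_zero hk hJ (fun e n n' s s' hs hs' e1 e2 => ?_) hf
    -- With `ε = 0` the exponent of `z` alone determines `s`; then `e1` becomes `k(n + 2e) = kn'`.
    obtain rfl : s = s' := by omega
    obtain rfl : n' = n + 2 * e := by
      refine Nat.eq_of_mul_eq_mul_left (show 0 < k by omega) ?_
      simp only [add_zero, mul_add, mul_assoc, mul_left_comm k 2] at e1 ⊢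
      omega
    rw [← sq_pow_mul_curveNF (mk_mul_mk_of_curveMinors_subset hJ) n s hs e]
    have := Ideal.Quotient.eq_zero_iff_mem.mpr (Ideal.subset_span
      (s := insert (X 0 * X 1 - curveCoord K k 0 ^ 2)
          (curveMinors K k : Set (MvPolynomial (Fin (k + 3)) K))) (Or.inl rfl))
    simp only [map_sub, map_mul, map_pow] at this
    rw [sub_eq_zero.mp this]
  · refine Ideal.span_le.mpr ?_
    rintro f (rfl | hf)
    · exact mem_homogeneousIdeal_surface (((isHomogeneous_X _ _).mul (isHomogeneous_X _ _)).sub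
        ((isHomogeneous_curveCoord k 0).pow 2)) (aeval_quadric k)
    · obtain ⟨i, j, hij, hj, rfl⟩ := mem_curveMinors.mp hf
      exact mem_homogeneousIdeal_surface (isHomogeneous_curveMinor k i j)
        (aeval_curveMinor 0 hij hj)

end Ideals

end GTSurface

end

theorem theorem7p2 (K : Type*) [Field K] [IsAlgClosed K] [CharZero K] (k : ℕ) :
    -- the odd case `d = 2k + 1`
    (3 ≤ 2 * k + 1 →
      GTSurface.homogeneousIdeal (GTSurface.surface K k 1)
          = GTSurface.minorsIdeal 2 (GTSurface.matrixA K k) ∧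
      ∃ Q C : Finset (MvPolynomial (Fin (k + 3)) K),
        Q.card = k.choose 2 ∧ (∀ q ∈ Q, q ≠ 0 ∧ q.IsHomogeneous 2) ∧
        C.card = k ∧ (∀ c ∈ C, c ≠ 0 ∧ c.IsHomogeneous 3) ∧
        GTSurface.homogeneousIdeal (GTSurface.surface K k 1)
          = Ideal.span ((Q : Set (MvPolynomial (Fin (k + 3)) K)) ∪ C)) ∧
    -- the even case `d = 2k`
    (3 ≤ 2 * k →
      GTSurface.homogeneousIdeal (GTSurface.surface K k 0)
          = GTSurface.minorsIdeal 2 (GTSurface.matrixB K k)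
            + Ideal.span {MvPolynomial.X 0 * MvPolynomial.X 1 - MvPolynomial.X 3 ^ 2} ∧
      ∃ Q : Finset (MvPolynomial (Fin (k + 3)) K),
        Q.card = 1 + k.choose 2 ∧ (∀ q ∈ Q, q ≠ 0 ∧ q.IsHomogeneous 2) ∧
        GTSurface.homogeneousIdeal (GTSurface.surface K k 0)
          = Ideal.span (Q : Set (MvPolynomial (Fin (k + 3)) K))) := by
  classical
  refine ⟨fun hd => ?_, fun hd => ?_⟩
  · have hk : 1 ≤ k := by omega
    have hI := GTSurface.homogeneousIdeal_surface_one (K := K) k hk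
    refine ⟨hI.trans (GTSurface.minorsIdeal_matrixA k hk).symm, GTSurface.curveMinors K k,
      GTSurface.surfaceCubics K k, GTSurface.card_curveMinors k, fun q hq => ?_,
      GTSurface.card_surfaceCubics k, fun c hc => ?_, hI⟩
    · obtain ⟨i, j, hij, hj, rfl⟩ := GTSurface.mem_curveMinors.mp hq
      exact ⟨GTSurface.curveMinor_ne_zero hij hj, GTSurface.isHomogeneous_curveMinor k i j⟩
    · obtain ⟨j, hj, rfl⟩ := GTSurface.mem_surfaceCubics.mp hc
      exact ⟨GTSurface.surfaceCubic_ne_zero hj, GTSurface.isHomogeneous_surfaceCubic k j⟩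
  · have hk : 1 ≤ k := by omega
    have hI := GTSurface.homogeneousIdeal_surface_zero (K := K) k hk
    refine ⟨?_, insert (X 0 * X 1 - GTSurface.curveCoord K k 0 ^ 2) (GTSurface.curveMinors K k),
      ?_, fun q hq => ?_, ?_⟩
    · rw [hI, GTSurface.minorsIdeal_matrixB, GTSurface.X_three k hk, Ideal.span_insert]
      exact sup_comm _ _
    · rw [Finset.card_insert_of_notMem (GTSurface.quadric_notMem_curveMinors k),
        GTSurface.card_curveMinors, add_comm]
    · rcases Finset.mem_insert.mp hq with rfl | hq
      · refine ⟨fun h => ?_, ((isHomogeneous_X _ _).mul (isHomogeneous_X _ _)).sub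
          ((GTSurface.isHomogeneous_curveCoord k 0).pow 2)⟩
        simpa [h] using GTSurface.eval_quadric (K := K) k
      · obtain ⟨i, j, hij, hj, rfl⟩ := GTSurface.mem_curveMinors.mp hq
        exact ⟨GTSurface.curveMinor_ne_zero hij hj, GTSurface.isHomogeneous_curveMinor k i j⟩
    · rw [hI, Finset.coe_insert]
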